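/- Let $0<q<1$, let $v>-1$ be real, let $N\in\mathbb Z$ and put $a=q^N$, $[0,a]_q=\{q^s : s\in\mathbb Z,\ s\ge N\}$. For $f:[0,a]_q\to\mathbb K$ (with $\mathbb K=\mathbb R$ or $\mathbb K=\mathbb C$) let $$\int_0^a f(t)\,d_qt=(1-q)\,a\sum_{k=0}^\infty q^kf(aq^k),$$ and let $\mathcal L_{q,v,a}$ be the Hilbert space of all functions $f:[0,a]_q\to\mathbb K$ with $\int_0^a|f(t)|^2t^{2v+1}\,d_qt<\infty$, with inner product $\langle f,g\rangle=\int_0^a \overline{f(t)}\,g(t)\,t^{2v+1}\,d_qt$. With $(z;q)_n=\prod_{i=0}^{n-1}(1-zq^i)$ for $0\le n\le\infty$, let $$j_v(z,q^2)=\sum_{n=0}^\infty(-1)^n\frac{q^{n(n+1)}}{(q^2;q^2)_n(q^{2v+2};q^2)_n}z^{2n},\qquad c_{q,v}=\frac1{1-q}\,\frac{(q^{2v+2};q^2)_\infty}{(q^2;q^2)_\infty},$$ and let $T_a^v$ be the linear operator of $\mathcal L_{q,v,a}$ into itself that is defined by $$T_a^vu(x)=c_{q,v}\int_0^au(t)\,j_v(xt,q^2)\,t^{2v+1}\,d_qt\qquad(x\in[0,a]_q).$$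 Then every eigenvalue of $T_a^v$ is real, and $0$ is not an eigenvalue of $T_a^v$. Moreover, there are an orthonormal basis $(\psi_i)_{i\ge 0}$ of $\mathcal L_{q,v,a}$ and a sequence $(\lambda_i)_{i\ge 0}$ of real numbers such that $T_a^v\psi_i=\lambda_i\psi_i$ for all $i$, every eigenvalue of $T_a^v$ is one of the $\lambda_i$, and $$\lambda_0^2\ge\lambda_1^2\ge\lambda_2^2\ge\cdots>0.$$ -/

import Mathlib

open MeasureTheory
open scoped ENNReal

noncomputable section

/-- The finite `q`-shifted factorial `(z;q)_n = ∏_{i=0}^{n-1} (1 - z q^i)`. -/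
def qPoch (z q : ℝ) (n : ℕ) : ℝ := ∏ i ∈ Finset.range n, (1 - z * q ^ i)

/-- The infinite `q`-shifted factorial `(z;q)_∞ = ∏_{i=0}^∞ (1 - z q^i)`. -/
def qPochInf (z q : ℝ) : ℝ := ∏' i : ℕ, (1 - z * q ^ i)

/-- The `n`-th term of the series of the normalized Hahn-Exton `q`-Bessel function
(the division by two in the exponent is exact). -/
def besselTerm (v q z : ℝ) (n : ℕ) : ℝ :=
  (-1) ^ n * (q ^ (n * (n + 1) / 2) / (qPoch q q n * qPoch (q ^ (v + 1)) q n)) * z ^ (2 * n)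

/-- The normalized Hahn-Exton `q`-Bessel function `j_v(z,q)` at a real point `z`. -/
def qBessel (v z q : ℝ) : ℝ := ∑' n : ℕ, besselTerm v q z n

/-- `c_{q,v} = (1-q)⁻¹ (q^{2v+2};q²)_∞ / (q²;q²)_∞`. -/
def qConst (q v : ℝ) : ℝ :=
  1 / (1 - q) * (qPochInf (q ^ (2 * v + 2)) (q ^ 2) / qPochInf (q ^ 2) (q ^ 2))

/-- The set `[0,a]_q = {q^s : s ∈ ℤ, s ≥ N}`, where `a = q^N`. -/
def qInterval (q : ℝ) (N : ℤ) : Set ℝ := {x | ∃ s : ℤ, N ≤ s ∧ x = q ^ s}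

/-- The point `a q^k = q^{N+k}` of `[0,a]_q`, where `a = q^N`. -/
def qPt (q : ℝ) (N : ℤ) (k : ℕ) : qInterval q N :=
  ⟨q ^ (N + (k : ℤ)), N + (k : ℤ), by omega, rfl⟩

/-- Jackson's integral `∫_0^a f(t) d_q t = (1-q) a ∑_{k≥0} q^k f(a q^k)`, where `a = q^N`. -/
def jackson {𝕜 : Type*} [RCLike 𝕜] (q : ℝ) (N : ℤ) (f : qInterval q N → 𝕜) : 𝕜 :=
  (((1 - q) * q ^ N : ℝ) : 𝕜) * ∑' k : ℕ, ((q ^ k : ℝ) : 𝕜) * f (qPt q N k)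

/-- The measure `t^{2v+1} d_q t` on `[0,a]_q`, where `a = q^N`: the point `a q^k` has mass
`(1-q) a q^k (a q^k)^{2v+1}`. -/
def qMeasure (q v : ℝ) (N : ℤ) : Measure (qInterval q N) :=
  Measure.sum fun k : ℕ =>
    ENNReal.ofReal ((1 - q) * q ^ N * q ^ k * (qPt q N k : ℝ) ^ (2 * v + 1)) •
      Measure.dirac (qPt q N k)

/-- The Hilbert space of the functions `f` on `[0,a]_q` with
`∫_0^a |f(x)|² x^{2v+1} d_q x < ∞`. All points of `[0,a]_q` have positive mass, so that
functions which agree almost everywhere are equal. -/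
abbrev qL2 (𝕜 : Type*) [RCLike 𝕜] (q v : ℝ) (N : ℤ) : Type _ := Lp 𝕜 2 (qMeasure q v N)

/-- `(T_a^v u)(x) = c_{q,v} ∫_0^a u(t) j_v(xt,q²) t^{2v+1} d_q t`, where `a = q^N`. -/
def qTFun {𝕜 : Type*} [RCLike 𝕜] (q v : ℝ) (N : ℤ) (u : qInterval q N → 𝕜)
    (x : qInterval q N) : 𝕜 :=
  ((qConst q v : ℝ) : 𝕜) * jackson q N fun t =>
    u t * ((qBessel v ((x : ℝ) * (t : ℝ)) (q ^ 2) : ℝ) : 𝕜) * (((t : ℝ) ^ (2 * v + 1) : ℝ) : 𝕜)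

/-! Facts which show that `T_a^v` is a linear operator of the Hilbert space into itself. -/

instance qInterval_countable (q : ℝ) (N : ℤ) : Countable (qInterval q N) := by
  have h : (qInterval q N).Countable :=
    (Set.countable_range fun s : ℤ => q ^ s).mono fun x hx => by
      obtain ⟨s, -, rfl⟩ := hx
      exact ⟨s, rfl⟩
  exact h.to_subtype

theorem qPt_pos {q : ℝ} (hq0 : 0 < q) (N : ℤ) (k : ℕ) : 0 < (qPt q N k : ℝ) :=
  zpow_pos hq0 _

theorem qWeight_nonneg {q : ℝ} (hq0 : 0 < q) (hq1 : q < 1) (v : ℝ) (N : ℤ) (k : ℕ) :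
    0 ≤ (1 - q) * q ^ N * q ^ k * (qPt q N k : ℝ) ^ (2 * v + 1) := by
  have := qPt_pos hq0 N k
  have : 0 ≤ 1 - q := by linarith
  positivity

theorem qMeasure_finite {q v : ℝ} (hq0 : 0 < q) (hq1 : q < 1) (hv : -1 < v) (N : ℤ) :
    IsFiniteMeasure (qMeasure q v N) := by
  constructor
  have hs : Summable fun k : ℕ =>
      (1 - q) * q ^ N * q ^ k * (qPt q N k : ℝ) ^ (2 * v + 1) := by
    have hg : Summable fun k : ℕ =>
        ((1 - q) * q ^ N * (q ^ N) ^ (2 * v + 1)) * (q ^ (2 * v + 2)) ^ k :=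
      (summable_geometric_of_lt_one (Real.rpow_nonneg hq0.le _)
        (Real.rpow_lt_one hq0.le hq1 (by linarith))).mul_left _
    refine hg.congr fun k => ?_
    have h1 : (qPt q N k : ℝ) = q ^ N * q ^ k := by
      simp [qPt, zpow_add₀ hq0.ne']
    have h2 : (q ^ (2 * v + 2)) ^ k = q ^ k * (q ^ k) ^ (2 * v + 1) := by
      rw [← Real.rpow_natCast (q ^ (2 * v + 2)) k, ← Real.rpow_mul hq0.le,
        ← Real.rpow_natCast q k, ← Real.rpow_mul hq0.le, ← Real.rpow_add hq0]
      congr 1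
      ring
    rw [h1, h2, Real.mul_rpow (zpow_nonneg hq0.le _) (pow_nonneg hq0.le _)]
    ring
  have h := hs.tsum_ofReal_ne_top
  rw [qMeasure, Measure.sum_apply _ MeasurableSet.univ]
  simpa using h.lt_top

theorem integral_qMeasure {𝕜 : Type*} [RCLike 𝕜] {q v : ℝ} (hq0 : 0 < q) (hq1 : q < 1) (N : ℤ)
    (f : qInterval q N → 𝕜) (hf : Integrable f (qMeasure q v N)) :
    ∫ t, f t ∂(qMeasure q v N) =
      jackson q N fun t => f t * (((t : ℝ) ^ (2 * v + 1) : ℝ) : 𝕜) := by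
  unfold qMeasure at hf ⊢
  rw [integral_sum_measure hf, jackson, ← tsum_mul_left]
  refine tsum_congr fun k => ?_
  rw [integral_smul_measure, integral_dirac, ENNReal.toReal_ofReal (qWeight_nonneg hq0 hq1 v N k),
    RCLike.real_smul_eq_coe_mul]
  push_cast
  ring

theorem besselTerm_summable {q v : ℝ} (hq0 : 0 < q) (hq1 : q < 1) (hv : -1 < v) (z : ℝ) :
    Summable (besselTerm v q z) := by
  rcases eq_or_ne z 0 with rfl | hz
  · refine summable_of_ne_finset_zero (s := {0}) fun n hn => ?_
    have : n ≠ 0 := by simpa using hn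
    simp [besselTerm, this]
  have hw0 : 0 < q ^ (v + 1) := Real.rpow_pos_of_pos hq0 _
  have hw1 : q ^ (v + 1) < 1 := Real.rpow_lt_one hq0.le hq1 (by linarith)
  have hf : ∀ w : ℝ, 0 < w → w < 1 → ∀ i : ℕ, 0 < 1 - w * q ^ i := fun w h0 h1 i => by
    have : q ^ i ≤ 1 := pow_le_one₀ hq0.le hq1.le
    nlinarith
  have hP : ∀ w : ℝ, 0 < w → w < 1 → ∀ n, 0 < qPoch w q n := fun w h0 h1 n =>
    Finset.prod_pos fun i _ => hf w h0 h1 i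
  have hne : ∀ n, besselTerm v q z n ≠ 0 := fun n => by
    have := hP q hq0 hq1 n
    have := hP _ hw0 hw1 n
    unfold besselTerm
    positivity
  have hratio : ∀ n, ‖besselTerm v q z (n + 1)‖ / ‖besselTerm v q z n‖ =
      q ^ (n + 1) * z ^ 2 / ((1 - q * q ^ n) * (1 - q ^ (v + 1) * q ^ n)) := fun n => by
    have a1 := hP q hq0 hq1 n
    have a2 := hP _ hw0 hw1 n
    have a3 := hf q hq0 hq1 n
    have a4 := hf _ hw0 hw1 n
    have ht : (n + 1) * (n + 1 + 1) / 2 = n * (n + 1) / 2 + (n + 1) := by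
      rw [show (n + 1) * (n + 1 + 1) = n * (n + 1) + (n + 1) * 2 by ring,
        Nat.add_mul_div_right _ _ (by norm_num)]
    have hs : ∀ w : ℝ, qPoch w q (n + 1) = qPoch w q n * (1 - w * q ^ n) := fun w =>
      Finset.prod_range_succ _ _
    have key : besselTerm v q z (n + 1) = -(besselTerm v q z n *
        (q ^ (n + 1) * z ^ 2 / ((1 - q * q ^ n) * (1 - q ^ (v + 1) * q ^ n)))) := by
      unfold besselTerm
      rw [ht, hs, hs]
      field_simp
      ring
    rw [key, norm_neg, norm_mul, mul_div_cancel_left₀ _ (norm_ne_zero_iff.2 (hne n)),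
      Real.norm_of_nonneg (by positivity)]
  have hq : Filter.Tendsto (fun n : ℕ => q ^ n) Filter.atTop (nhds 0) :=
    tendsto_pow_atTop_nhds_zero_of_lt_one hq0.le hq1
  refine summable_of_ratio_test_tendsto_lt_one (l := 0) one_pos
    (Filter.Eventually.of_forall hne) ?_
  simp_rw [hratio]
  have h1 := ((hq.comp (Filter.tendsto_add_atTop_nat 1)).mul_const (z ^ 2)).div
    (((hq.const_mul q).const_sub 1).mul ((hq.const_mul (q ^ (v + 1))).const_sub 1)) (by norm_num)
  simpa [Pi.div_def] using h1

theorem qBessel_bound {q v : ℝ} (hq0 : 0 < q) (hq1 : q < 1) (hv : -1 < v) (N : ℤ) :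
    ∃ C : ℝ, ∀ x t : qInterval q N, |qBessel v ((x : ℝ) * (t : ℝ)) (q ^ 2)| ≤ C := by
  have hs := fun z => besselTerm_summable (v := v) (pow_pos hq0 2) (by nlinarith : q ^ 2 < 1) hv z
  refine ⟨∑' n, |besselTerm v (q ^ 2) (q ^ N * q ^ N) n|, fun x t => ?_⟩
  have hle : ∀ x : qInterval q N, 0 ≤ (x : ℝ) ∧ (x : ℝ) ≤ q ^ N := by
    rintro ⟨_, s, hs, rfl⟩
    exact ⟨zpow_nonneg hq0.le _, zpow_le_zpow_right_of_le_one₀ hq0 hq1.le hs⟩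
  have hz0 : 0 ≤ (x : ℝ) * (t : ℝ) := mul_nonneg (hle x).1 (hle t).1
  have hz1 : (x : ℝ) * (t : ℝ) ≤ q ^ N * q ^ N :=
    mul_le_mul (hle x).2 (hle t).2 (hle t).1 (zpow_nonneg hq0.le _)
  have h2 : |qBessel v ((x : ℝ) * (t : ℝ)) (q ^ 2)| ≤
      ∑' n, |besselTerm v (q ^ 2) ((x : ℝ) * (t : ℝ)) n| := by
    simpa [qBessel] using norm_tsum_le_tsum_norm (hs ((x : ℝ) * (t : ℝ))).norm
  refine h2.trans ((hs _).abs.tsum_le_tsum (fun n => ?_) (hs _).abs)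
  unfold besselTerm
  rw [abs_mul, abs_mul _ ((q ^ N * q ^ N) ^ (2 * n)), abs_pow, abs_pow, abs_of_nonneg hz0,
    abs_of_nonneg (hz0.trans hz1)]
  gcongr

section operator

variable {𝕜 : Type*} [RCLike 𝕜] {q v : ℝ}

theorem qL2_integrable (hq0 : 0 < q) (hq1 : q < 1) (hv : -1 < v) (N : ℤ) (u : qL2 𝕜 q v N) :
    Integrable u (qMeasure q v N) := by
  have := qMeasure_finite hq0 hq1 hv N
  exact (Lp.memLp u).integrable (by norm_num)

theorem qKernel_integrable (hq0 : 0 < q) (hq1 : q < 1) (hv : -1 < v) (N : ℤ)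
    (u : qL2 𝕜 q v N) (x : qInterval q N) :
    Integrable (fun t => u t * ((qBessel v ((x : ℝ) * (t : ℝ)) (q ^ 2) : ℝ) : 𝕜))
      (qMeasure q v N) := by
  obtain ⟨C, hC⟩ := qBessel_bound hq0 hq1 hv N
  refine (qL2_integrable hq0 hq1 hv N u).mul_bdd (c := C)
    (measurable_of_countable _).aestronglyMeasurable (Filter.Eventually.of_forall fun t => ?_)
  simpa using hC x t

theorem qTFun_eq_integral (hq0 : 0 < q) (hq1 : q < 1) (hv : -1 < v) (N : ℤ)
    (u : qL2 𝕜 q v N) (x : qInterval q N) :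
    qTFun q v N u x = ((qConst q v : ℝ) : 𝕜) *
      ∫ t, u t * ((qBessel v ((x : ℝ) * (t : ℝ)) (q ^ 2) : ℝ) : 𝕜) ∂(qMeasure q v N) := by
  rw [qTFun, integral_qMeasure hq0 hq1 N _ (qKernel_integrable hq0 hq1 hv N u x)]

theorem qTFun_memLp (hq0 : 0 < q) (hq1 : q < 1) (hv : -1 < v) (N : ℤ) (u : qL2 𝕜 q v N) :
    MemLp (qTFun q v N u) 2 (qMeasure q v N) := by
  have := qMeasure_finite hq0 hq1 hv N
  obtain ⟨C, hC⟩ := qBessel_bound hq0 hq1 hv N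
  refine MemLp.of_bound (measurable_of_countable _).aestronglyMeasurable
    (|qConst q v| * ∫ t, ‖u t‖ * C ∂(qMeasure q v N)) (Filter.Eventually.of_forall fun x => ?_)
  rw [qTFun_eq_integral hq0 hq1 hv, norm_mul, RCLike.norm_ofReal]
  refine mul_le_mul_of_nonneg_left (norm_integral_le_of_norm_le
    ((qL2_integrable hq0 hq1 hv N u).norm.mul_const C)
    (Filter.Eventually.of_forall fun t => ?_)) (abs_nonneg _)
  rw [norm_mul, RCLike.norm_ofReal]
  exact mul_le_mul_of_nonneg_left (hC x t) (norm_nonneg _)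

/-- The operator `T_a^v` on the Hilbert space of the square integrable functions on `[0,a]_q`,
where `a = q^N`. -/
def qT (𝕜 : Type*) [RCLike 𝕜] {q v : ℝ} (hq0 : 0 < q) (hq1 : q < 1) (hv : -1 < v) (N : ℤ) :
    qL2 𝕜 q v N →ₗ[𝕜] qL2 𝕜 q v N where
  toFun u := (qTFun_memLp hq0 hq1 hv N u).toLp (qTFun q v N u)
  map_add' u w := by
    rw [← MemLp.toLp_add]
    refine MemLp.toLp_congr _ _ (Filter.Eventually.of_forall fun x => ?_)
    rw [Pi.add_apply, qTFun_eq_integral hq0 hq1 hv, qTFun_eq_integral hq0 hq1 hv,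
      qTFun_eq_integral hq0 hq1 hv, ← mul_add, ← integral_add (qKernel_integrable hq0 hq1 hv N u x)
        (qKernel_integrable hq0 hq1 hv N w x)]
    congr 1
    refine integral_congr_ae ?_
    filter_upwards [Lp.coeFn_add u w] with t ht
    rw [ht, Pi.add_apply, add_mul]
  map_smul' c u := by
    rw [RingHom.id_apply, ← MemLp.toLp_const_smul]
    refine MemLp.toLp_congr _ _ (Filter.Eventually.of_forall fun x => ?_)
    rw [Pi.smul_apply, qTFun_eq_integral hq0 hq1 hv, qTFun_eq_integral hq0 hq1 hv, smul_eq_mul,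
      mul_left_comm, ← MeasureTheory.integral_const_mul (μ := qMeasure q v N) (L := 𝕜) c]
    congr 1
    refine integral_congr_ae ?_
    filter_upwards [Lp.coeFn_smul c u] with t ht
    rw [ht, Pi.smul_apply, smul_eq_mul, mul_assoc]

end operator

end

noncomputable section

/-! Expanding the Bessel function turns the kernel into `∑ d_n x^{2n} t^{2n}` with real nonzero
`d_n`. So `T_a^v = ∑ d_n p_n ⊗ p_n` with `p_n = t^{2n}`, and the sum converges in operator norm
because the Bessel series converges absolutely at `a²`. A norm limit of symmetric finite-rank
operators is compact and symmetric (`exists_hasSum_qT`).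

Injectivity uses one uniqueness principle twice (`eq_zero_of_forall_tsum_mul_pow_eq_zero`): a power
series with summable coefficients that vanishes at all `r^j` is zero. If `T_a^v u = 0`, the series
`∑ d_n ⟨p_n, u⟩ x^{2n}` vanishes at every `x = q^{N+k}`, so all moments `⟨p_n, u⟩` vanish. The
`n`-th moment is, up to a nonzero factor, the value at `q^{2n}` of the power series with
coefficients `w_k u(q^{N+k})`, where `w_k > 0` is the mass of the point; hence `u = 0`.

The spectral theorem then gives an orthonormal basis of eigenvectors. The eigenvalues are nonzero
and accumulate only at `0`, so they can be listed by decreasing modulus. -/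

/-! ### Enumeration in decreasing order. -/

/-- A family of reals with finite superlevel sets on an infinite type can be enumerated in
decreasing order. -/
theorem exists_equiv_nat_antitone {ι : Type*} [Infinite ι] [Countable ι] (f : ι → ℝ)
    (hf : ∀ i, {j | f i ≤ f j}.Finite) : ∃ e : ℕ ≃ ι, Antitone (f ∘ e) := by
  obtain ⟨g, hg⟩ := exists_injective_nat ι
  -- Larger values of `f` come first; ties are broken by the injection `g`, which makes the order
  -- linear.
  let r : ι → ℝᵒᵈ ×ₗ ℕ := fun i => toLex (OrderDual.toDual (f i), g i)
  have hr : Function.Injective r := fun i j hij => hg (congrArg (fun p => (ofLex p).2) hij)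
  let : LinearOrder ι := LinearOrder.lift' r hr
  have hle : ∀ i j : ι, i ≤ j → f j ≤ f i := fun i j hij => by
    have h : r i ≤ r j := hij
    rcases Prod.Lex.toLex_le_toLex.1 h with h | h
    · exact le_of_lt h
    · exact le_of_eq (congrArg OrderDual.ofDual h.1).symm
  -- Initial segments lie in superlevel sets, hence are finite. An infinite linear order with this
  -- property is isomorphic to `ℕ`.
  have hfin : ∀ i : ι, (Set.Iic i).Finite := fun i => (hf i).subset fun j hj => hle j i hj
  let : LocallyFiniteOrder ι := LocallyFiniteOrder.ofFiniteIcc fun a b =>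
    (hfin b).subset fun x hx => hx.2
  obtain ⟨i₀⟩ := (inferInstance : Nonempty ι)
  obtain ⟨b, hb⟩ := (hfin i₀).exists_minimal ⟨i₀, Set.mem_Iic.2 le_rfl⟩
  let : OrderBot ι :=
    { bot := b
      bot_le := fun x => by
        rcases le_total b x with h | h
        · exact h
        · exact hb.2 (h.trans hb.1) h }
  have : NoMaxOrder ι := ⟨fun a => by
    by_contra! h
    exact Set.infinite_univ ((hfin a).subset fun x _ => h x)⟩
  let : SuccOrder ι := LinearLocallyFiniteOrder.succOrder ι
  let : PredOrder ι := LinearLocallyFiniteOrder.predOrder ι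
  exact ⟨(orderIsoNatOfLinearSuccPredArch (ι := ι)).symm.toEquiv, fun m n hmn =>
    hle _ _ ((orderIsoNatOfLinearSuccPredArch (ι := ι)).symm.monotone hmn)⟩

/-! ### Diagonalization of compact symmetric operators. -/

section spectral

variable {𝕜 E : Type*} [RCLike 𝕜] [NormedAddCommGroup E] [InnerProductSpace 𝕜 E]

open Module.End

/-- The eigenvalues of a compact operator along an orthonormal family of eigenvectors have finite
superlevel sets. -/
theorem IsCompactOperator.finite_setOf_le_norm_eigenvalue {T : E →L[𝕜] E}
    (hT : IsCompactOperator T) {ι : Type*} {b : ι → E} (hb : Orthonormal 𝕜 b) {l : ι → 𝕜}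
    (hl : ∀ i, T (b i) = l i • b i) {ε : ℝ} (hε : 0 < ε) : {i | ε ≤ ‖l i‖}.Finite := by
  by_contra hinf
  obtain ⟨K, hK, hKsub⟩ := hT.image_closedBall_subset_compact (f := (T : E →ₗ[𝕜] E)) 1
  obtain ⟨t, ht, hcov⟩ := Metric.totallyBounded_iff.1 hK.totallyBounded (ε / 2) (by positivity)
  have hmem : ∀ i, ∃ y ∈ t, dist (T (b i)) y < ε / 2 := fun i => by
    have h1 : T (b i) ∈ K := hKsub ⟨b i, by simp [hb.1 i], rfl⟩
    simpa using hcov h1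
  choose y hyt hy using hmem
  -- Pigeonhole: two of infinitely many images lie in the same ball of radius `ε / 2`. Yet pairing
  -- their difference with `b i` gives `l i`, so they are at least `ε` apart.
  obtain ⟨i, hi, j, -, hij, hyy⟩ := Set.Infinite.exists_ne_map_eq_of_mapsTo (s := {i | ε ≤ ‖l i‖})
    hinf (fun i _ => hyt i) ht
  have hdist : dist (T (b i)) (T (b j)) < ε := by
    have h1 := dist_triangle_right (T (b i)) (T (b j)) (y i)
    have h2 := hy i
    have h3 := hy j
    rw [← hyy] at h3
    linarith
  have hinner : inner 𝕜 (b i) (T (b i) - T (b j)) = l i := by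
    rw [hl, hl, inner_sub_right, inner_smul_right, inner_smul_right, hb.2 hij,
      inner_self_eq_norm_sq_to_K, hb.1 i]
    simp
  have hle := norm_inner_le_norm (𝕜 := 𝕜) (b i) (T (b i) - T (b j))
  rw [hinner, hb.1 i, one_mul, ← dist_eq_norm] at hle
  exact absurd (hi.trans hle) (not_le.2 hdist)

/-- An injective compact symmetric operator of an infinite-dimensional Hilbert space is
diagonalized by an orthonormal sequence with eigenvalues of decreasing modulus. -/
theorem IsCompactOperator.exists_hilbertBasis_nat [CompleteSpace E] {T : E →L[𝕜] E}
    (hT : IsCompactOperator T) (hs : (T : E →ₗ[𝕜] E).IsSymmetric)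
    (h0 : ¬ HasEigenvalue (T : E →ₗ[𝕜] E) 0) (hE : ¬ FiniteDimensional 𝕜 E) :
    ∃ (ψ : HilbertBasis ℕ 𝕜 E) (l : ℕ → ℝ), (∀ i, T (ψ i) = (l i : 𝕜) • ψ i) ∧
      (∀ i, |l (i + 1)| ≤ |l i|) ∧ ∀ i, l i ≠ 0 := by
  have hfd : ∀ μ : 𝕜, FiniteDimensional 𝕜 (eigenspace (T : E →ₗ[𝕜] E) μ) := fun μ => by
    rcases eq_or_ne μ 0 with rfl | hμ
    · rw [hasEigenvalue_iff, not_not] at h0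
      rw [h0]
      infer_instance
    · exact T.finite_dimensional_eigenspace hT μ hμ
  let B : ∀ μ : 𝕜, OrthonormalBasis (Fin (Module.finrank 𝕜 (eigenspace (T : E →ₗ[𝕜] E) μ))) 𝕜
    (eigenspace (T : E →ₗ[𝕜] E) μ) := fun μ => stdOrthonormalBasis 𝕜 _
  -- All scalars may index the sum: the fibre over a non-eigenvalue is `Fin 0`.
  let ι := Σ μ : 𝕜, Fin (Module.finrank 𝕜 (eigenspace (T : E →ₗ[𝕜] E) μ))
  let b : ι → E := fun a => (B a.1 a.2 : E)
  have hb : Orthonormal 𝕜 b :=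
    hs.orthogonalFamily_eigenspaces.orthonormal_sigma_orthonormal fun μ => (B μ).orthonormal
  have hTb : ∀ a, T (b a) = a.1 • b a := fun a => mem_eigenspace_iff.1 (B a.1 a.2).2
  have hbne : ∀ a, b a ≠ 0 := fun a => hb.ne_zero a
  have hev : ∀ a : ι, HasEigenvalue (T : E →ₗ[𝕜] E) a.1 := fun a =>
    hasEigenvalue_of_hasEigenvector ⟨mem_eigenspace_iff.2 (hTb a), hbne a⟩
  have hne : ∀ a : ι, a.1 ≠ 0 := fun a ha => h0 (ha ▸ hev a)
  have hreal : ∀ a : ι, ((RCLike.re a.1 : ℝ) : 𝕜) = a.1 := fun a =>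
    RCLike.conj_eq_iff_re.1 (hs.conj_eigenvalue_eq_self (hev a))
  have hsp : (Submodule.span 𝕜 (Set.range b))ᗮ = ⊥ := by
    rw [eq_bot_iff, ← T.orthogonalComplement_iSup_eigenspaces_eq_bot hT hs]
    refine Submodule.orthogonal_le (iSup_le fun μ x hx => ?_)
    have h1 := (B μ).sum_repr ⟨x, hx⟩
    have h2 := congrArg (Submodule.subtype _) h1
    rw [map_sum] at h2
    have h3 : x = ∑ i, (B μ).repr ⟨x, hx⟩ i • (B μ i : E) := h2.symm
    rw [h3]
    exact Submodule.sum_mem _ fun i _ => Submodule.smul_mem _ _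
      (Submodule.subset_span ⟨⟨μ, i⟩, rfl⟩)
  have hfin : ∀ ε : ℝ, 0 < ε → {a : ι | ε ≤ ‖a.1‖}.Finite := fun ε hε =>
    hT.finite_setOf_le_norm_eigenvalue hb hTb hε
  -- No eigenvalue is zero, so the finite sets `1 / (n + 1) ≤ ‖μ‖` exhaust the index type.
  have : Countable ι := by
    have hU : (Set.univ : Set ι) = ⋃ n : ℕ, {a : ι | 1 / ((n : ℝ) + 1) ≤ ‖a.1‖} := by
      refine (Set.eq_univ_of_forall fun a => ?_).symm
      obtain ⟨n, hn⟩ := exists_nat_one_div_lt (norm_pos_iff.2 (hne a))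
      exact Set.mem_iUnion.2 ⟨n, hn.le⟩
    refine Set.countable_univ_iff.1 ?_
    rw [hU]
    exact Set.countable_iUnion fun n => (hfin _ (by positivity)).countable
  let ψ : HilbertBasis ι 𝕜 E := HilbertBasis.mkOfOrthogonalEqBot hb hsp
  have : Infinite ι := by
    by_contra hi
    rw [not_infinite_iff_finite] at hi
    have := Fintype.ofFinite ι
    exact hE ψ.toOrthonormalBasis.toBasis.finiteDimensional_of_finite
  obtain ⟨e, he⟩ := exists_equiv_nat_antitone (fun a : ι => ‖a.1‖) fun a =>
    hfin _ (norm_pos_iff.2 (hne a))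
  have hnorm : ∀ a : ι, |RCLike.re a.1| = ‖a.1‖ := fun a => by
    rw [← RCLike.norm_ofReal (K := 𝕜), hreal]
  have hb' : Orthonormal 𝕜 (b ∘ e) := hb.comp _ e.injective
  refine ⟨HilbertBasis.mkOfOrthogonalEqBot hb' ?_, fun n => RCLike.re (e n).1, fun n => ?_,
    fun n => ?_, fun n => ?_⟩
  · rwa [e.surjective.range_comp]
  · rw [HilbertBasis.coe_mkOfOrthogonalEqBot, hreal]
    exact hTb (e n)
  · rw [hnorm, hnorm]
    exact he (Nat.le_succ n)
  · rw [← abs_pos, hnorm]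
    exact norm_pos_iff.2 (hne _)

/-- An eigenvalue of a symmetric operator occurs along every Hilbert basis of eigenvectors. -/
theorem HilbertBasis.exists_eq_of_hasEigenvalue {ι : Type*} (ψ : HilbertBasis ι 𝕜 E)
    {T : E →ₗ[𝕜] E} (hs : T.IsSymmetric) {l : ι → ℝ} (hl : ∀ i, T (ψ i) = (l i : 𝕜) • ψ i)
    {μ : 𝕜} (hμ : HasEigenvalue T μ) : ∃ i, μ = (l i : 𝕜) := by
  obtain ⟨x, hx, hx0⟩ := hμ.exists_hasEigenvector
  rw [mem_eigenspace_iff] at hx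
  by_contra! h
  refine hx0 (ψ.repr.map_eq_zero_iff.1 (lp.ext (funext fun i => ?_)))
  -- Symmetry gives `l i * ⟨ψ i, x⟩ = μ * ⟨ψ i, x⟩`, so every coefficient of `x` vanishes if `μ` is
  -- none of the `l i`.
  have h1 := hs (ψ i) x
  rw [hl, hx, inner_smul_left, inner_smul_right, RCLike.conj_ofReal] at h1
  rw [ψ.repr_apply_apply]
  by_contra h2
  exact h i (mul_right_cancel₀ h2 h1).symm

/-- A summable combination of rank one operators is compact. -/
theorem isCompactOperator_of_hasSum_rankOne [CompleteSpace E] {T : E →L[𝕜] E} {d : ℕ → 𝕜}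
    {p p' : ℕ → E} (h : HasSum (fun n => d n • InnerProductSpace.rankOne 𝕜 (p n) (p' n)) T) :
    IsCompactOperator T := by
  refine isCompactOperator_of_tendsto h (Filter.Eventually.of_forall fun s => ?_)
  refine Submodule.sum_mem (compactOperator (RingHom.id 𝕜) E E) fun n _ =>
    Submodule.smul_mem _ _ ?_
  change IsCompactOperator _
  rw [InnerProductSpace.rankOne_def']
  exact (isCompactOperator_of_locallyCompactSpace_rng
    (ContinuousLinearMap.toSpanSingleton 𝕜 (p n))).comp_clm (innerSL 𝕜 (p' n))

/-- A summable real combination of self-adjoint rank one operators is symmetric. -/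
theorem isSymmetric_of_hasSum_rankOne {T : E →L[𝕜] E} {d : ℕ → ℝ} {p : ℕ → E}
    (h : HasSum (fun n => (d n : 𝕜) • InnerProductSpace.rankOne 𝕜 (p n) (p n)) T) :
    (T : E →ₗ[𝕜] E).IsSymmetric := by
  have hT : ∀ x, HasSum (fun n => (d n : 𝕜) • inner 𝕜 (p n) x • p n) (T x) := fun x => by
    simpa using h.mapL (ContinuousLinearMap.apply 𝕜 E x)
  intro x y
  have h1 := ((hT x).mapL (innerSL 𝕜 y)).star
  have h2 := (hT y).mapL (innerSL 𝕜 x)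
  simp only [innerSL_apply_apply, RCLike.star_def, inner_conj_symm] at h1 h2
  refine h1.unique (h2.congr_fun fun n => ?_)
  rw [inner_smul_left, inner_smul_right, inner_smul_left, inner_smul_right, RCLike.conj_ofReal,
    inner_conj_symm]
  ring

end spectral

/-! ### Uniqueness of power series on a geometric progression. -/

/-- A summable sequence is determined by the values of its generating function along a geometric
progression. -/
theorem eq_zero_of_forall_tsum_mul_pow_eq_zero {𝕜 : Type*} [RCLike 𝕜] {r : ℝ} (hr0 : 0 < r)
    (hr1 : r < 1) {b : ℕ → 𝕜} (hb : Summable b)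
    (h : ∀ j : ℕ, ∑' k, b k * ((r : 𝕜) ^ j) ^ k = 0) : b = 0 := by
  funext k
  induction k using Nat.strong_induction_on with
  | _ k ih =>
    have hr : (r : 𝕜) ≠ 0 := by simpa using hr0.ne'
    have hnorm : ‖(r : 𝕜)‖ = r := by rw [RCLike.norm_ofReal, abs_of_pos hr0]
    have hb' : Summable fun i => ‖b (i + k)‖ := (summable_nat_add_iff k).2 hb.norm
    -- The coefficients below `k` vanish by induction, so the nonzero factor `(r ^ j) ^ k` can be
    -- divided out.
    have hshift : ∀ j : ℕ, ∑' i, b (i + k) * ((r : 𝕜) ^ j) ^ i = 0 := fun j => by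
      have hle : ‖(r : 𝕜) ^ j‖ ≤ 1 := by
        rw [norm_pow, hnorm]
        exact pow_le_one₀ hr0.le hr1.le
      have hs : Summable fun i => b i * ((r : 𝕜) ^ j) ^ i := by
        refine Summable.of_norm_bounded hb.norm fun i => ?_
        rw [norm_mul, norm_pow]
        exact mul_le_of_le_one_right (norm_nonneg _) (pow_le_one₀ (norm_nonneg _) hle)
      have h1 := hs.sum_add_tsum_nat_add k
      rw [h j, Finset.sum_eq_zero fun i hi => by simp [ih i (Finset.mem_range.1 hi)], zero_add] at h1
      simp only [pow_add, ← mul_assoc] at h1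
      rw [tsum_mul_right] at h1
      exact (mul_eq_zero.1 h1).resolve_right (pow_ne_zero _ (pow_ne_zero _ hr))
    -- As `j → ∞`, `r ^ j → 0` and only the constant term `b k` survives.
    have hlim := tendsto_tsum_of_dominated_convergence (𝓕 := Filter.atTop)
      (f := fun (j : ℕ) (i : ℕ) => b (i + k) * ((r : 𝕜) ^ j) ^ i)
      (g := fun i => if i = 0 then b k else 0) hb' (fun i => by
        rcases eq_or_ne i 0 with rfl | hi
        · simp
        · have h1 : Filter.Tendsto (fun j : ℕ => (r : 𝕜) ^ j) Filter.atTop (nhds 0) :=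
            tendsto_pow_atTop_nhds_zero_of_norm_lt_one (by rwa [hnorm])
          simpa [hi] using (h1.pow i).const_mul (b (i + k))) (Filter.Eventually.of_forall fun j i => by
        rw [norm_mul, norm_pow, norm_pow, hnorm]
        exact mul_le_of_le_one_right (norm_nonneg _)
          (pow_le_one₀ (by positivity) (pow_le_one₀ hr0.le hr1.le)))
    simp only [hshift, tsum_ite_eq] at hlim
    exact (tendsto_nhds_unique hlim tendsto_const_nhds)

/-! ### Nonvanishing of the constants; points and masses of `[0,a]_q`. -/

theorem qPochInf_ne_zero {z q : ℝ} (hz0 : 0 < z) (hz1 : z < 1) (hq0 : 0 < q) (hq1 : q < 1) :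
    qPochInf z q ≠ 0 := by
  have h := tprod_one_add_ne_zero_of_summable (f := fun i : ℕ => -(z * q ^ i)) (fun i => by
    have : q ^ i ≤ 1 := pow_le_one₀ hq0.le hq1.le
    have : z * q ^ i < 1 := by nlinarith [pow_pos hq0 i]
    linarith) (by
    simpa using ((summable_geometric_of_lt_one hq0.le hq1).mul_left z).norm)
  simpa [qPochInf, sub_eq_add_neg] using h

theorem qConst_ne_zero {q v : ℝ} (hq0 : 0 < q) (hq1 : q < 1) (hv : -1 < v) : qConst q v ≠ 0 := by
  have hq2 : q ^ 2 < 1 := by nlinarith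
  have h1 := qPochInf_ne_zero (Real.rpow_pos_of_pos hq0 (2 * v + 2))
    (Real.rpow_lt_one hq0.le hq1 (by linarith)) (pow_pos hq0 2) hq2
  have h2 := qPochInf_ne_zero (pow_pos hq0 2) hq2 (pow_pos hq0 2) hq2
  have h3 : 1 - q ≠ 0 := by linarith
  unfold qConst
  positivity

theorem qPoch_pos {z q : ℝ} (hz0 : 0 < z) (hz1 : z < 1) (hq0 : 0 < q) (hq1 : q < 1) (n : ℕ) :
    0 < qPoch z q n :=
  Finset.prod_pos fun i _ => by
    have : q ^ i ≤ 1 := pow_le_one₀ hq0.le hq1.le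
    nlinarith [pow_pos hq0 i]

theorem besselTerm_eq_mul (v q z : ℝ) (n : ℕ) :
    besselTerm v q z n = besselTerm v q 1 n * z ^ (2 * n) := by
  simp [besselTerm]

theorem besselTerm_ne_zero {q v : ℝ} (hq0 : 0 < q) (hq1 : q < 1) (hv : -1 < v) {z : ℝ}
    (hz : z ≠ 0) (n : ℕ) : besselTerm v q z n ≠ 0 := by
  have h1 := qPoch_pos hq0 hq1 hq0 hq1 n
  have h2 := qPoch_pos (Real.rpow_pos_of_pos hq0 (v + 1))
    (Real.rpow_lt_one hq0.le hq1 (by linarith)) hq0 hq1 n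
  unfold besselTerm
  positivity

theorem qInterval_nonneg {q : ℝ} (hq0 : 0 < q) {N : ℤ} (x : qInterval q N) : 0 ≤ (x : ℝ) := by
  obtain ⟨_, s, hs, rfl⟩ := x
  exact zpow_nonneg hq0.le _

theorem qInterval_le {q : ℝ} (hq0 : 0 < q) (hq1 : q < 1) {N : ℤ} (x : qInterval q N) :
    (x : ℝ) ≤ q ^ N := by
  obtain ⟨_, s, hs, rfl⟩ := x
  exact zpow_le_zpow_right_of_le_one₀ hq0 hq1.le hs

theorem qPt_surjective (q : ℝ) (N : ℤ) : Function.Surjective (qPt q N) := by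
  rintro ⟨_, s, hs, rfl⟩
  refine ⟨(s - N).toNat, Subtype.ext ?_⟩
  simp only [qPt]
  congr 1
  omega

theorem qPt_injective {q : ℝ} (hq0 : 0 < q) (hq1 : q < 1) (N : ℤ) :
    Function.Injective (qPt q N) := fun j k h => by
  have h1 : q ^ (N + (j : ℤ)) = q ^ (N + (k : ℤ)) := congrArg Subtype.val h
  have h2 := zpow_right_injective₀ hq0 hq1.ne h1
  omega

theorem qPt_pow {q : ℝ} (hq0 : 0 < q) (N : ℤ) (k n : ℕ) :
    (qPt q N k : ℝ) ^ (2 * n) = (q ^ N) ^ (2 * n) * ((q ^ 2) ^ k) ^ n := by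
  have h1 : (qPt q N k : ℝ) = q ^ N * q ^ k := by
    simp [qPt, zpow_add₀ hq0.ne']
  rw [h1]
  ring

theorem qWeight_pos {q : ℝ} (hq0 : 0 < q) (hq1 : q < 1) (v : ℝ) (N : ℤ) (k : ℕ) :
    0 < (1 - q) * q ^ N * q ^ k * (qPt q N k : ℝ) ^ (2 * v + 1) := by
  have := qPt_pos hq0 N k
  have : 0 < 1 - q := by linarith
  positivity

theorem qMeasure_singleton_ne_zero {q : ℝ} (hq0 : 0 < q) (hq1 : q < 1) (v : ℝ) {N : ℤ}
    (x : qInterval q N) : qMeasure q v N {x} ≠ 0 := by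
  obtain ⟨k, rfl⟩ := qPt_surjective q N x
  refine ((ENNReal.ofReal_pos.2 (qWeight_pos hq0 hq1 v N k)).trans_le ?_).ne'
  have h2 := Measure.le_sum (fun k : ℕ =>
    ENNReal.ofReal ((1 - q) * q ^ N * q ^ k * (qPt q N k : ℝ) ^ (2 * v + 1)) •
      Measure.dirac (qPt q N k)) k {qPt q N k}
  simpa [qMeasure] using h2

/-- Every point has positive mass, so the only null set is empty. This is what allows elements of
`Lp` to be evaluated pointwise. -/
theorem qMeasure_ae_iff {q : ℝ} (hq0 : 0 < q) (hq1 : q < 1) (v : ℝ) {N : ℤ}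
    {p : qInterval q N → Prop} : (∀ᵐ x ∂qMeasure q v N, p x) ↔ ∀ x, p x := by
  rw [ae_iff_of_countable]
  exact forall_congr' fun x => by simp [qMeasure_singleton_ne_zero hq0 hq1 v x]

/-! ### Expansion of `T_a^v` in rank one operators. -/

section operator

variable {𝕜 : Type*} [RCLike 𝕜] {q v : ℝ}

theorem qL2_ext {N : ℤ} {u w : qL2 𝕜 q v N} (h : ∀ x, u x = w x) :
    u = w :=
  Lp.ext (Filter.Eventually.of_forall h)

theorem qMonomial_memLp (𝕜 : Type*) [RCLike 𝕜] (hq0 : 0 < q) (hq1 : q < 1) (hv : -1 < v) (N : ℤ)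
    (n : ℕ) : MemLp (fun t : qInterval q N => (((t : ℝ) ^ (2 * n) : ℝ) : 𝕜)) 2
      (qMeasure q v N) := by
  have := qMeasure_finite hq0 hq1 hv N
  refine MemLp.of_bound (measurable_of_countable _).aestronglyMeasurable ((q ^ N) ^ (2 * n))
    (Filter.Eventually.of_forall fun x => ?_)
  rw [RCLike.norm_ofReal, abs_of_nonneg (pow_nonneg (qInterval_nonneg hq0 x) _)]
  exact pow_le_pow_left₀ (qInterval_nonneg hq0 x) (qInterval_le hq0 hq1 x) _

/-- The even monomial `t ^ (2 n)` as an element of the Hilbert space. -/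
def qMonomial (𝕜 : Type*) [RCLike 𝕜] {q v : ℝ} (hq0 : 0 < q) (hq1 : q < 1) (hv : -1 < v) (N : ℤ)
    (n : ℕ) : qL2 𝕜 q v N :=
  (qMonomial_memLp 𝕜 hq0 hq1 hv N n).toLp _

theorem qMonomial_apply (hq0 : 0 < q) (hq1 : q < 1) (hv : -1 < v) (N : ℤ) (n : ℕ)
    (x : qInterval q N) :
    qMonomial 𝕜 hq0 hq1 hv N n x = (((x : ℝ) ^ (2 * n) : ℝ) : 𝕜) :=
  (qMeasure_ae_iff hq0 hq1 v).1 (qMonomial_memLp 𝕜 hq0 hq1 hv N n).coeFn_toLp x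

theorem qT_apply (hq0 : 0 < q) (hq1 : q < 1) (hv : -1 < v) (N : ℤ) (u : qL2 𝕜 q v N)
    (x : qInterval q N) : qT 𝕜 hq0 hq1 hv N u x = qTFun q v N u x :=
  (qMeasure_ae_iff hq0 hq1 v).1 (qTFun_memLp hq0 hq1 hv N u).coeFn_toLp x

theorem inner_qMonomial (hq0 : 0 < q) (hq1 : q < 1) (hv : -1 < v) (N : ℤ) (n : ℕ)
    (u : qL2 𝕜 q v N) : inner 𝕜 (qMonomial 𝕜 hq0 hq1 hv N n) u =
      ∫ t, u t * (((t : ℝ) ^ (2 * n) : ℝ) : 𝕜) ∂qMeasure q v N := by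
  rw [L2.inner_def]
  refine integral_congr_ae (Filter.Eventually.of_forall fun t => ?_)
  simp only [qMonomial_apply, RCLike.inner_apply, RCLike.conj_ofReal]

/-- The coefficients of the expansion of `T_a^v` in rank one operators. -/
def qCoeff (q v : ℝ) (n : ℕ) : ℝ := qConst q v * besselTerm v (q ^ 2) 1 n

theorem qCoeff_ne_zero (hq0 : 0 < q) (hq1 : q < 1) (hv : -1 < v) (n : ℕ) : qCoeff q v n ≠ 0 :=
  mul_ne_zero (qConst_ne_zero hq0 hq1 hv)
    (besselTerm_ne_zero (pow_pos hq0 2) (by nlinarith) hv one_ne_zero n)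

theorem qMonomial_mul_integrable (hq0 : 0 < q) (hq1 : q < 1) (hv : -1 < v) (N : ℤ) (n : ℕ)
    (u : qL2 𝕜 q v N) : Integrable (fun t => u t * (((t : ℝ) ^ (2 * n) : ℝ) : 𝕜))
      (qMeasure q v N) := by
  refine (qL2_integrable hq0 hq1 hv N u).mul_bdd (c := (q ^ N) ^ (2 * n))
    (measurable_of_countable _).aestronglyMeasurable (Filter.Eventually.of_forall fun x => ?_)
  rw [RCLike.norm_ofReal, abs_of_nonneg (pow_nonneg (qInterval_nonneg hq0 x) _)]
  exact pow_le_pow_left₀ (qInterval_nonneg hq0 x) (qInterval_le hq0 hq1 x) _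

/-- This is absolute convergence of the Bessel series at `a²`, the largest value of `xt`. The powers
of `a = q ^ N` must be kept, since `a > 1` when `N < 0`. -/
theorem qCoeff_summable (hq0 : 0 < q) (hq1 : q < 1) (hv : -1 < v) (N : ℤ) :
    Summable fun n => |qCoeff q v n| * ((q ^ N) ^ (2 * n) * (q ^ N) ^ (2 * n)) := by
  refine (((besselTerm_summable (v := v) (pow_pos hq0 2) (by nlinarith) hv
    (q ^ N * q ^ N)).mul_left (qConst q v)).abs).congr fun n => ?_
  have : 0 ≤ (q ^ N * q ^ N) ^ (2 * n) := by positivity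
  rw [besselTerm_eq_mul, ← mul_assoc, abs_mul, abs_of_nonneg this, qCoeff, mul_pow]

/-- The pointwise expansion of `T_a^v u` in even monomials. -/
theorem hasSum_qTFun (hq0 : 0 < q) (hq1 : q < 1) (hv : -1 < v) (N : ℤ) (u : qL2 𝕜 q v N)
    (x : qInterval q N) :
    HasSum (fun n => (qCoeff q v n : 𝕜) * inner 𝕜 (qMonomial 𝕜 hq0 hq1 hv N n) u *
      (((x : ℝ) ^ (2 * n) : ℝ) : 𝕜)) (qTFun q v N u x) := by
  have hx := qInterval_nonneg hq0 x
  let F : ℕ → qInterval q N → 𝕜 := fun n t =>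
    ((qCoeff q v n * (x : ℝ) ^ (2 * n) : ℝ) : 𝕜) * (u t * (((t : ℝ) ^ (2 * n) : ℝ) : 𝕜))
  have hF : ∀ n, Integrable (F n) (qMeasure q v N) := fun n =>
    (qMonomial_mul_integrable hq0 hq1 hv N n u).const_mul _
  -- Bounding both `x` and `t` by `a` justifies exchanging sum and integral.
  have hFs : Summable fun n => ∫ t, ‖F n t‖ ∂qMeasure q v N := by
    refine Summable.of_nonneg_of_le (fun n => integral_nonneg fun t => norm_nonneg _) (fun n => ?_)
      ((qCoeff_summable hq0 hq1 hv N).mul_right (∫ t, ‖u t‖ ∂qMeasure q v N))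
    rw [← integral_const_mul]
    refine integral_mono (hF n).norm ((qL2_integrable hq0 hq1 hv N u).norm.const_mul _) fun t => ?_
    have ht := qInterval_nonneg hq0 t
    simp only [F]
    rw [norm_mul, norm_mul, RCLike.norm_ofReal, RCLike.norm_ofReal, abs_mul,
      abs_of_nonneg (pow_nonneg hx _), abs_of_nonneg (pow_nonneg ht _)]
    calc |qCoeff q v n| * (x : ℝ) ^ (2 * n) * (‖u t‖ * (t : ℝ) ^ (2 * n))
        = |qCoeff q v n| * ((x : ℝ) ^ (2 * n) * (t : ℝ) ^ (2 * n)) * ‖u t‖ := by ring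
      _ ≤ _ := by
        gcongr
        · exact qInterval_le hq0 hq1 x
        · exact qInterval_le hq0 hq1 t
  have h := hasSum_integral_of_summable_integral_norm hF hFs
  have hsum : ∀ t, ∑' n, F n t = (qConst q v : 𝕜) *
      (u t * ((qBessel v ((x : ℝ) * (t : ℝ)) (q ^ 2) : ℝ) : 𝕜)) := fun t => by
    rw [qBessel, RCLike.ofReal_tsum, ← tsum_mul_left, ← tsum_mul_left]
    refine tsum_congr fun n => ?_
    simp only [F]
    rw [besselTerm_eq_mul, mul_pow, qCoeff]
    push_cast
    ring
  simp only [hsum] at h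
  rw [integral_const_mul, ← qTFun_eq_integral hq0 hq1 hv] at h
  refine h.congr_fun fun n => ?_
  rw [integral_const_mul, inner_qMonomial]
  push_cast
  ring

theorem norm_qMonomial_le (hq0 : 0 < q) (hq1 : q < 1) (hv : -1 < v) (N : ℤ) (n : ℕ) :
    ‖qMonomial 𝕜 hq0 hq1 hv N n‖ ≤
      (qMeasure q v N).real Set.univ ^ ((2 : ℝ)⁻¹) * (q ^ N) ^ (2 * n) := by
  have := qMeasure_finite hq0 hq1 hv N
  have h := Lp.norm_le_of_ae_bound (μ := qMeasure q v N) (p := 2)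
    (f := qMonomial 𝕜 hq0 hq1 hv N n) (C := (q ^ N) ^ (2 * n)) (by positivity)
    (Filter.Eventually.of_forall fun x => by
      rw [qMonomial_apply, RCLike.norm_ofReal,
        abs_of_nonneg (pow_nonneg (qInterval_nonneg hq0 x) _)]
      exact pow_le_pow_left₀ (qInterval_nonneg hq0 x) (qInterval_le hq0 hq1 x) _)
  change _ ≤ (((qMeasure q v N) Set.univ).toNNReal : ℝ) ^ ((2 : ℝ)⁻¹) * _
  simpa [measureUnivNNReal] using h

theorem summable_qRankOne (hq0 : 0 < q) (hq1 : q < 1) (hv : -1 < v) (N : ℤ) :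
    Summable fun n => (qCoeff q v n : 𝕜) • InnerProductSpace.rankOne 𝕜
      (qMonomial 𝕜 hq0 hq1 hv N n) (qMonomial 𝕜 hq0 hq1 hv N n) := by
  refine Summable.of_norm_bounded ((qCoeff_summable hq0 hq1 hv N).mul_left
    ((qMeasure q v N).real Set.univ ^ ((2 : ℝ)⁻¹) * (qMeasure q v N).real Set.univ ^ ((2 : ℝ)⁻¹)))
    fun n => ?_
  rw [norm_smul, InnerProductSpace.norm_rankOne, RCLike.norm_ofReal]
  have h := norm_qMonomial_le (𝕜 := 𝕜) hq0 hq1 hv N n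
  set M := (qMeasure q v N).real Set.univ ^ ((2 : ℝ)⁻¹)
  calc _ ≤ |qCoeff q v n| * ((M * (q ^ N) ^ (2 * n)) * (M * (q ^ N) ^ (2 * n))) := by gcongr
    _ = _ := by ring

/-- The indicator function of the point `x` in the Hilbert space. -/
def qSingle (𝕜 : Type*) [RCLike 𝕜] {q v : ℝ} (hq0 : 0 < q) (hq1 : q < 1) (hv : -1 < v) (N : ℤ)
    (x : qInterval q N) : qL2 𝕜 q v N :=
  indicatorConstLp 2 (measurableSet_singleton x)
    (by have := qMeasure_finite hq0 hq1 hv N; exact measure_ne_top _ _) 1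

theorem inner_qSingle (hq0 : 0 < q) (hq1 : q < 1) (hv : -1 < v) (N : ℤ) (x : qInterval q N)
    (u : qL2 𝕜 q v N) : inner 𝕜 (qSingle 𝕜 hq0 hq1 hv N x) u =
      ((qMeasure q v N).real {x} : 𝕜) * u x := by
  rw [qSingle, L2.inner_indicatorConstLp_one, integral_singleton, RCLike.real_smul_eq_coe_mul]

theorem qMeasure_real_singleton_ne_zero (hq0 : 0 < q) (hq1 : q < 1) (hv : -1 < v) {N : ℤ}
    (x : qInterval q N) : (((qMeasure q v N).real {x} : ℝ) : 𝕜) ≠ 0 := by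
  have := qMeasure_finite hq0 hq1 hv N
  rw [RCLike.ofReal_ne_zero, Measure.real, ENNReal.toReal_ne_zero]
  exact ⟨qMeasure_singleton_ne_zero hq0 hq1 v x, measure_ne_top _ _⟩

/-- The indicators of the points `q^{N+k}` form an infinite orthogonal family of nonzero vectors. -/
theorem qL2_not_finiteDimensional (hq0 : 0 < q) (hq1 : q < 1) (hv : -1 < v) (N : ℤ) :
    ¬ FiniteDimensional 𝕜 (qL2 𝕜 q v N) := fun hfin => by
  have hs : ∀ x y : qInterval q N, qSingle 𝕜 hq0 hq1 hv N x y =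
      Set.indicator {x} (fun _ => (1 : 𝕜)) y := fun x y =>
    (qMeasure_ae_iff hq0 hq1 v).1 indicatorConstLp_coeFn y
  have hli : LinearIndependent 𝕜 fun k : ℕ => qSingle 𝕜 hq0 hq1 hv N (qPt q N k) := by
    refine linearIndependent_of_ne_zero_of_inner_eq_zero (fun k hk => ?_) fun j k hjk => ?_
    · have h1 := inner_qSingle hq0 hq1 hv N (qPt q N k) (qSingle 𝕜 hq0 hq1 hv N (qPt q N k))
      rw [hs, hk, inner_zero_left] at h1
      exact qMeasure_real_singleton_ne_zero (𝕜 := 𝕜) hq0 hq1 hv (qPt q N k) (by simpa using h1.symm)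
    · change inner 𝕜 (qSingle 𝕜 hq0 hq1 hv N _) (qSingle 𝕜 hq0 hq1 hv N _) = 0
      rw [inner_qSingle, hs, Set.indicator_of_notMem, mul_zero]
      exact fun h => hjk (qPt_injective hq0 hq1 N h)
  exact not_finite_iff_infinite.2 inferInstance hli.finite

/-- The rank one expansion of `T_a^v`. -/
theorem exists_hasSum_qT (hq0 : 0 < q) (hq1 : q < 1) (hv : -1 < v) (N : ℤ) :
    ∃ S : qL2 𝕜 q v N →L[𝕜] qL2 𝕜 q v N, (S : qL2 𝕜 q v N →ₗ[𝕜] qL2 𝕜 q v N) =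
      qT 𝕜 hq0 hq1 hv N ∧ HasSum (fun n => (qCoeff q v n : 𝕜) • InnerProductSpace.rankOne 𝕜
        (qMonomial 𝕜 hq0 hq1 hv N n) (qMonomial 𝕜 hq0 hq1 hv N n)) S := by
  obtain ⟨S, hS⟩ := summable_qRankOne (𝕜 := 𝕜) hq0 hq1 hv N
  refine ⟨S, LinearMap.ext fun u => qL2_ext fun x => ?_, hS⟩
  -- Pairing with the indicator of `x` is evaluation at `x` times its mass, so norm convergence
  -- yields the pointwise expansion.
  have h1 := (hS.mapL (ContinuousLinearMap.apply 𝕜 _ u)).mapL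
    (innerSL 𝕜 (qSingle 𝕜 hq0 hq1 hv N x))
  simp only [ContinuousLinearMap.apply_apply, smul_apply,
    InnerProductSpace.rankOne_apply, innerSL_apply_apply, inner_smul_right, inner_qSingle,
    qMonomial_apply] at h1
  have h2 := (hasSum_qTFun hq0 hq1 hv N u x).mul_left (((qMeasure q v N).real {x} : ℝ) : 𝕜)
  rw [qT_apply]
  refine mul_left_cancel₀ (qMeasure_real_singleton_ne_zero (𝕜 := 𝕜) (v := v) hq0 hq1 hv x)
    (h1.unique (h2.congr_fun fun n => ?_))
  ring

/-! ### Injectivity of `T_a^v`. -/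

theorem qMoment_injective (hq0 : 0 < q) (hq1 : q < 1) (hv : -1 < v) (N : ℤ) {u : qL2 𝕜 q v N}
    (h : ∀ n, inner 𝕜 (qMonomial 𝕜 hq0 hq1 hv N n) u = 0) : u = 0 := by
  let W : ℕ → ℝ := fun k => (1 - q) * q ^ N * q ^ k * (qPt q N k : ℝ) ^ (2 * v + 1)
  have hsum : ∀ f : qInterval q N → 𝕜, Integrable f (qMeasure q v N) →
      HasSum (fun k => (W k : 𝕜) * f (qPt q N k)) (∫ t, f t ∂qMeasure q v N) := fun f hf => by
    refine (hasSum_integral_measure hf).congr_fun fun k => ?_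
    rw [integral_smul_measure, integral_dirac, ENNReal.toReal_ofReal (qWeight_nonneg hq0 hq1 v N k),
      RCLike.real_smul_eq_coe_mul]
  have hb : (fun k => (W k : 𝕜) * u (qPt q N k)) = 0 := by
    refine eq_zero_of_forall_tsum_mul_pow_eq_zero (pow_pos hq0 2) (by nlinarith : q ^ 2 < 1)
      (hsum u (qL2_integrable hq0 hq1 hv N u)).summable fun n => ?_
    have h1 := hsum _ (qMonomial_mul_integrable hq0 hq1 hv N n u)
    rw [← inner_qMonomial hq0 hq1 hv, h n] at h1
    have ha : (((q ^ N) ^ (2 * n) : ℝ) : 𝕜) ≠ 0 := by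
      rw [RCLike.ofReal_ne_zero]
      positivity
    refine (mul_eq_zero.1 ?_).resolve_left ha
    rw [← tsum_mul_left, ← h1.tsum_eq]
    refine tsum_congr fun k => ?_
    -- The exponents are swapped, `((q²)^k)^n = ((q²)^n)^k`, to read the moment as a power series in
    -- `(q²)^n` indexed by `k`.
    rw [qPt_pow hq0, ← pow_mul (q ^ 2) k n, mul_comm k n, pow_mul (q ^ 2) n k]
    push_cast
    ring
  refine qL2_ext fun x => ?_
  obtain ⟨k, rfl⟩ := qPt_surjective q N x
  rw [(qMeasure_ae_iff hq0 hq1 v).1 (Lp.coeFn_zero 𝕜 2 (qMeasure q v N)) (qPt q N k)]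
  refine (mul_eq_zero.1 (congrFun hb k)).resolve_left (RCLike.ofReal_ne_zero.2 ?_)
  exact (qWeight_pos hq0 hq1 v N k).ne'

theorem qT_injective (hq0 : 0 < q) (hq1 : q < 1) (hv : -1 < v) (N : ℤ) {u : qL2 𝕜 q v N}
    (h : qT 𝕜 hq0 hq1 hv N u = 0) : u = 0 := by
  have hx : ∀ x, qTFun q v N u x = 0 := fun x => by
    rw [← qT_apply hq0 hq1 hv, h]
    exact (qMeasure_ae_iff hq0 hq1 v).1 (Lp.coeFn_zero 𝕜 2 (qMeasure q v N)) x
  -- Here the roles are reversed: the value at `q^{N+k}` is a power series in `(q²)^k` indexed by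
  -- `n`. The case `k = 0` supplies summability of the coefficients.
  have hk : ∀ k : ℕ, HasSum (fun n => (qCoeff q v n : 𝕜) *
      inner 𝕜 (qMonomial 𝕜 hq0 hq1 hv N n) u * (((q ^ N) ^ (2 * n) : ℝ) : 𝕜) *
        (((q ^ 2 : ℝ) : 𝕜) ^ k) ^ n) 0 := fun k => by
    have h1 := hasSum_qTFun hq0 hq1 hv N u (qPt q N k)
    rw [hx] at h1
    refine h1.congr_fun fun n => ?_
    rw [qPt_pow hq0]
    push_cast
    ring
  have h0 := eq_zero_of_forall_tsum_mul_pow_eq_zero (pow_pos hq0 2) (by nlinarith : q ^ 2 < 1)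
    (by simpa using (hk 0).summable) fun k => (hk k).tsum_eq
  refine qMoment_injective hq0 hq1 hv N fun n => ?_
  have h1 := congrFun h0 n
  have ha : (((q ^ N) ^ (2 * n) : ℝ) : 𝕜) ≠ 0 := by
    rw [RCLike.ofReal_ne_zero]
    positivity
  exact (mul_eq_zero.1 ((mul_eq_zero.1 h1).resolve_right ha)).resolve_left
    (RCLike.ofReal_ne_zero.2 (qCoeff_ne_zero hq0 hq1 hv n))

end operator

end

/-! ### The spectrum of `T_a^v`. -/

theorem proposition3 {𝕜 : Type*} [RCLike 𝕜] {q v : ℝ} (hq0 : 0 < q) (hq1 : q < 1) (hv : -1 < v)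
    (N : ℤ) :
    (∀ μ : 𝕜, Module.End.HasEigenvalue (qT 𝕜 hq0 hq1 hv N) μ → ∃ r : ℝ, μ = (r : 𝕜)) ∧
    (∃ (ψ : HilbertBasis ℕ 𝕜 (qL2 𝕜 q v N)) (lam : ℕ → ℝ),
      (∀ i, qT 𝕜 hq0 hq1 hv N (ψ i) = (lam i : 𝕜) • ψ i) ∧
      (∀ μ : 𝕜, Module.End.HasEigenvalue (qT 𝕜 hq0 hq1 hv N) μ ↔ ∃ i, μ = (lam i : 𝕜)) ∧
      (∀ i, lam (i + 1) ^ 2 ≤ lam i ^ 2) ∧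
      (∀ i, 0 < lam i ^ 2)) ∧
    ¬ Module.End.HasEigenvalue (qT 𝕜 hq0 hq1 hv N) (0 : 𝕜) := by
  obtain ⟨S, hST, hS⟩ := exists_hasSum_qT (𝕜 := 𝕜) hq0 hq1 hv N
  have hsymm := isSymmetric_of_hasSum_rankOne hS
  have h0 : ¬ Module.End.HasEigenvalue (qT 𝕜 hq0 hq1 hv N) (0 : 𝕜) := fun h => by
    obtain ⟨u, hu, hu0⟩ := h.exists_hasEigenvector
    rw [Module.End.mem_eigenspace_iff, zero_smul] at hu
    exact hu0 (qT_injective hq0 hq1 hv N hu)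
  obtain ⟨ψ, l, hl, hanti, hne⟩ := (isCompactOperator_of_hasSum_rankOne hS).exists_hilbertBasis_nat
    hsymm (by rwa [hST]) (qL2_not_finiteDimensional hq0 hq1 hv N)
  rw [hST] at hsymm
  have hl' : ∀ i, qT 𝕜 hq0 hq1 hv N (ψ i) = (l i : 𝕜) • ψ i := fun i => by
    rw [← hST]
    exact hl i
  have hex : ∀ μ : 𝕜, Module.End.HasEigenvalue (qT 𝕜 hq0 hq1 hv N) μ → ∃ i, μ = (l i : 𝕜) :=
    fun μ hμ => ψ.exists_eq_of_hasEigenvalue hsymm hl' hμ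
  refine ⟨fun μ hμ => (hex μ hμ).imp' l fun i hi => hi, ⟨ψ, l, hl', fun μ => ⟨hex μ, ?_⟩,
    fun i => sq_le_sq.2 (hanti i), fun i => sq_pos_of_ne_zero (hne i)⟩, h0⟩
  rintro ⟨i, rfl⟩
  exact Module.End.hasEigenvalue_of_hasEigenvector
    ⟨Module.End.mem_eigenspace_iff.2 (hl' i), ψ.orthonormal.ne_zero i⟩
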